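/- Let $n\ge 0$ and let $\overrightarrow{G}=([n],E)$ be a simple digraph, i.e. $E$ is a set of ordered pairs of distinct elements of $[n]=\{1,\dots,n\}$ (both $(u,v)$ and $(v,u)$ may belong to $E$). Let $G$ be its underlying undirected simple graph, in which $u\ne v$ are adjacent if and only if $(u,v)\in E$ or $(v,u)\in E$. For an integer $m\ge 0$ put $$\chi_{\overrightarrow{G}}(m,t)=\sum_{\kappa}t^{\mathrm{asc}(\kappa)},$$ where $\kappa$ runs over all proper colorings $\kappa:[n]\to[m]$ of $G$ and $\mathrm{asc}(\kappa)$ is the number of $(u,v)\in E$ with $\kappa(u)<\kappa(v)$. For a permutation $\sigma=\sigma_1\sigma_2\cdots\sigma_n\in\mathfrak S_n$, a $\overrightarrow{G}$-inversion of $\sigma$ is a directed edge $(u,v)\in E$ such that $v$ precedes $u$ in $\sigma$. For $x\in[n]$, the rank $\mathrm{rank}_{(G,\sigma)}(x)$ is the length of the longest (not necessarily contiguous) subword of $\sigma$ that ends in $x$ and in which any two consecutive letters are adjacent in $G$. A $G$-descent of $\sigma$ is an $i$ with $1\le i<n$ such that either $\mathrm{rank}_{(G,\sigma)}(\sigma_i)>\mathrm{rank}_{(G,\sigma)}(\sigma_{i+1})$,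 or $\mathrm{rank}_{(G,\sigma)}(\sigma_i)=\mathrm{rank}_{(G,\sigma)}(\sigma_{i+1})$ and $\sigma_i>\sigma_{i+1}$. For $k,l\ge 0$ let $\delta_{\overrightarrow{G}}(k,l)$ be the number of $\sigma\in\mathfrak S_n$ with exactly $k$ $G$-descents and exactly $l$ $\overrightarrow{G}$-inversions; only finitely many of these numbers are nonzero. Then for every integer $m\ge 0$ $$\chi_{\overrightarrow{G}}(m,t)=\sum_{k,l\ge 0}\delta_{\overrightarrow{G}}(k,l)\binom{m+k}{n}t^l .$$ Consequently $\chi_{\overrightarrow{G}}(m,t)$ is a polynomial in $m$ whose coefficients are palindromic polynomials in $t$: there are $a_0(t),\dots,a_d(t)\in\mathbb Q[t]$ with $\chi_{\overrightarrow{G}}(m,t)=\sum_{j=0}^d a_j(t)m^j$ for all integers $m\ge 0$, and each $a_j(t)=\sum_{i=0}^{|E|}a_{j,i}t^i$ satisfies $a_{j,i}=a_{j,|E|-i}$ for $0\le i\le |E|$. -/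

import Mathlib

open Polynomial

open scoped Classical in
/-- The finite set of directed edges `(u, v)` of a digraph. -/
noncomputable def diEdges {V : Type*} [Fintype V] (D : Digraph V) : Finset (V × V) :=
  Finset.univ.filter fun e => D.Adj e.1 e.2

/-- The number of ascents of a coloring `κ`: directed edges `(u, v)` with `κ u < κ v`. -/
noncomputable def ascCount {V : Type*} [Fintype V] (D : Digraph V) {m : ℕ} (κ : V → Fin m) : ℕ :=
  ((diEdges D).filter fun e => κ e.1 < κ e.2).card

/-- The `t`-analog of the chromatic polynomial of a digraph, evaluated at the number `m` of colors,
as a polynomial in the variable `t`: the sum of `t ^ asc κ` over all proper colorings `κ` of the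
underlying undirected graph with colors in an ordered set of `m` colors. -/
noncomputable def tChromatic {V : Type*} [Fintype V] (D : Digraph V) (m : ℕ) : ℚ[X] :=
  ∑ κ : D.toSimpleGraphInclusive.Coloring (Fin m), X ^ ascCount D κ

/-- The number of inversions of `σ` with respect to a digraph: directed edges `(u, v)` such that
`v` precedes `u` in the word `σ 0, σ 1, …, σ (n - 1)`. -/
noncomputable def diInv {n : ℕ} (D : Digraph (Fin n)) (σ : Equiv.Perm (Fin n)) : ℕ :=
  ((diEdges D).filter fun e => σ.symm e.2 < σ.symm e.1).card

/-- The `(G, σ)`-rank of `x`: the length of the longest subword of `σ 0, σ 1, …, σ (n - 1)` which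
ends in `x` and in which consecutive letters are adjacent in `G`. The set of lengths contains `1`
and is bounded by `n`, so its supremum is its maximum. -/
noncomputable def gRank {n : ℕ} (G : SimpleGraph (Fin n)) (σ : Equiv.Perm (Fin n)) (x : Fin n) :
    ℕ :=
  sSup {k : ℕ | ∃ w : List (Fin n), List.Sublist w (List.ofFn σ) ∧ w.getLast? = some x ∧
    w.IsChain G.Adj ∧ w.length = k}

open scoped Classical in
/-- The set of `G`-descents of `σ`; positions are numbered from `0`, so a `G`-descent at the
position `i` compares the letters `σ i` and `σ (i + 1)`, where `i + 1 < n`. -/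
noncomputable def gDescents {n : ℕ} (G : SimpleGraph (Fin n)) (σ : Equiv.Perm (Fin n)) :
    Finset (Fin n) :=
  Finset.univ.filter fun i => ∃ h : (i : ℕ) + 1 < n,
    gRank G σ (σ ⟨(i : ℕ) + 1, h⟩) < gRank G σ (σ i) ∨
      (gRank G σ (σ i) = gRank G σ (σ ⟨(i : ℕ) + 1, h⟩) ∧ σ ⟨(i : ℕ) + 1, h⟩ < σ i)

/-- The number of permutations with exactly `k` descents with respect to the underlying undirected
graph and exactly `l` inversions with respect to the digraph. -/
noncomputable def diDelta {n : ℕ} (D : Digraph (Fin n)) (k l : ℕ) : ℕ :=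
  (Finset.univ.filter fun σ : Equiv.Perm (Fin n) =>
    (gDescents D.toSimpleGraphInclusive σ).card = k ∧ diInv D σ = l).card

/-- A polynomial `∑_{i ≤ N} aᵢ tⁱ` with `aᵢ = a_{N - i}`, that is, palindromic with center of
symmetry `N / 2`. -/
def IsPalindromicOfCenter (N : ℕ) (p : ℚ[X]) : Prop :=
  p.natDegree ≤ N ∧ ∀ i ≤ N, p.coeff i = p.coeff (N - i)

/-!
Every proper coloring `κ` is sorted by exactly one permutation `σ`: list the vertices by decreasing
color, breaking ties by decreasing rank and then by decreasing label. This is not circular, because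
the rank depends only on the acyclic orientation of the graph induced by `σ`, and adjacent vertices
have different colors, so that this orientation is read off `κ`. Along `σ` the ascents of `κ` are
the inversions of `σ`. Conversely `σ` sorts `κ` if and only if the colors decrease weakly along `σ`,
strictly at the steps which are not descents; adding to each color the number of descents from its
position on leaves strictly decreasing sequences of length `n` in `m + des σ` colors.

Reversing the colors turns the ascents of `κ` into the edges which are not ascents, so the value at
every `m` is palindromic. Palindromicity is a set of linear conditions, and a linear functional
which vanishes on all values of a polynomial in `m` vanishes on its coefficients.
-/

open Finset OrderDual

/-! ### Weakly decreasing sequences -/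

/-- `a` decreases weakly, and every step at which it stays constant starts at an element of `D`. -/
def AntitoneStrictOff {ι α : Type*} [Preorder ι] [LT α] (D : Finset ι) (a : ι → α) : Prop :=
  ∀ i j, i ⋖ j → a j < a i ∨ a j = a i ∧ i ∈ D

/-- The number of elements of `D` from `i` on. Adding it to a sequence which is strictly decreasing
off `D` makes the sequence strictly decreasing everywhere. -/
def stepShift {ι : Type*} [LinearOrder ι] (D : Finset ι) (i : ι) : ℕ :=
  #{k ∈ D | i ≤ k}

theorem stepShift_le_card {ι : Type*} [LinearOrder ι] (D : Finset ι) (i : ι) :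
    stepShift D i ≤ #D :=
  card_filter_le _ _

theorem stepShift_of_covBy {ι : Type*} [LinearOrder ι] (D : Finset ι) {i j : ι} (hij : i ⋖ j) :
    stepShift D i = stepShift D j + if i ∈ D then 1 else 0 := by
  have hle : ∀ k, i ≤ k ↔ j ≤ k ∨ k = i := fun k => by
    rw [le_iff_lt_or_eq, ← Set.mem_Ioi, hij.Ioi_eq, Set.mem_Ici, eq_comm]
  have hdisj : Disjoint {k ∈ D | j ≤ k} {k ∈ D | k = i} :=
    disjoint_filter.2 fun k _ hjk hki => hij.lt.not_ge (hki ▸ hjk)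
  simp only [stepShift, hle]
  rw [filter_or, card_union_of_disjoint hdisj, filter_eq']
  split_ifs <;> simp

theorem antitoneStrictOff_iff_strictAnti_add_stepShift {ι : Type*} [LinearOrder ι]
    [LocallyFiniteOrder ι] {D : Finset ι} {a : ι → ℕ} :
    AntitoneStrictOff D a ↔ StrictAnti (a + stepShift D) := by
  rw [strictAnti_iff_forall_covBy]
  refine forall₃_congr fun i j hij => ?_
  rw [Pi.add_apply, Pi.add_apply, stepShift_of_covBy D hij]
  by_cases hi : i ∈ D
  · simp only [hi, and_true, if_true]
    omega
  · simp [hi]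

theorem stepShift_le_of_strictAnti {ι : Type*} [LinearOrder ι] [Finite ι] {D : Finset ι}
    (hD : ∀ k ∈ D, ¬ IsMax k) {b : ι → ℕ} (hb : StrictAnti b) (i : ι) : stepShift D i ≤ b i := by
  cases nonempty_fintype ι
  classical
  obtain ⟨t, hit, ht⟩ := Set.finite_univ.exists_le_maximal (Set.mem_univ i)
  have hlt : stepShift D i < #{k | i ≤ k} :=
    card_lt_card <| (ssubset_iff_of_subset (filter_subset_filter _ (subset_univ D))).2
      ⟨t, by simpa using hit, fun h => hD t (mem_filter.1 h).1 fun k hk => ht.2 trivial hk⟩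
  have hle : #{k | i ≤ k} ≤ #(Iic (b i)) :=
    card_le_card_of_injOn b (fun k hk => mem_Iic.2 (hb.antitone (by simpa using hk)))
      hb.injective.injOn
  rw [Nat.card_Iic] at hle
  omega

theorem lt_add_stepShift_of_strictAnti {ι : Type*} [LinearOrder ι] [Finite ι] {D : Finset ι}
    {m : ℕ} {b : ι → ℕ} (hb : StrictAnti b) (hlt : ∀ i, b i < m + #D) (i : ι) :
    b i < m + stepShift D i := by
  cases nonempty_fintype ι
  have hsplit : stepShift D i + #{k ∈ D | k < i} = #D := by
    simpa [stepShift] using card_filter_add_card_filter_not (s := D) (i ≤ ·)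
  have hle : #{k ∈ D | k < i} ≤ #(Ioo (b i) (m + #D)) :=
    card_le_card_of_injOn b (fun k hk => mem_Ioo.2 ⟨hb (mem_filter.1 hk).2, hlt k⟩)
      hb.injective.injOn
  rw [Nat.card_Ioo] at hle
  have := hlt i
  omega

theorem card_strictAnti (n : ℕ) (α : Type*) [LinearOrder α] [Finite α] :
    Nat.card {b : Fin n → α // StrictAnti b} = (Nat.card α).choose n := by
  let e : {b : Fin n → α // StrictAnti b} ≃ (Fin n ↪o αᵒᵈ) :=
    { toFun b := OrderEmbedding.ofStrictMono (toDual ∘ b.1) b.2.dual_right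
      invFun f := ⟨ofDual ∘ f, f.strictMono.dual_right⟩
      left_inv _ := rfl
      right_inv _ := by ext; rfl }
  rw [Nat.card_congr (e.trans Set.powersetCard.ofFinEmbEquiv), Set.powersetCard.card]
  rfl

theorem antitoneStrictOff_comp_iff {ι α β : Type*} [Preorder ι] [LinearOrder α] [Preorder β]
    {D : Finset ι} {f : α → β} (hf : StrictMono f) {a : ι → α} :
    AntitoneStrictOff D (f ∘ a) ↔ AntitoneStrictOff D a := by
  simp only [AntitoneStrictOff, Function.comp_apply, hf.lt_iff_lt, hf.injective.eq_iff]

/-- Adding `stepShift D` turns the sequences with entries below `m` that are strictly decreasing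
off `D` into the strictly decreasing sequences with entries below `m + #D`. -/
def antitoneStrictOffEquiv {n : ℕ} (m : ℕ) {D : Finset (Fin n)} (hD : ∀ k ∈ D, ¬ IsMax k) :
    {a : Fin n → Fin m // AntitoneStrictOff D a} ≃
      {b : Fin n → Fin (m + #D) // StrictAnti b} where
  toFun a := ⟨fun i => ⟨a.1 i + stepShift D i, add_lt_add_of_lt_of_le (a.1 i).2
      (stepShift_le_card D i)⟩,
    antitoneStrictOff_iff_strictAnti_add_stepShift.1
      ((antitoneStrictOff_comp_iff Fin.val_strictMono).2 a.2)⟩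
  invFun b :=
    have hb : StrictAnti (Fin.val ∘ b.1) := Fin.val_strictMono.comp_strictAnti b.2
    have hle := stepShift_le_of_strictAnti hD hb
    ⟨fun i => ⟨b.1 i - stepShift D i, Nat.sub_lt_right_of_lt_add (hle i)
        (lt_add_stepShift_of_strictAnti hb (fun i => (b.1 i).2) i)⟩,
      (antitoneStrictOff_comp_iff Fin.val_strictMono).1 <|
        antitoneStrictOff_iff_strictAnti_add_stepShift.2 <| by
          convert hb
          exact funext fun i => Nat.sub_add_cancel (hle i)⟩
  left_inv a := by ext; simp
  right_inv b := by
    ext i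
    exact Nat.sub_add_cancel
      (stepShift_le_of_strictAnti hD (Fin.val_strictMono.comp_strictAnti b.2) i)

theorem card_antitoneStrictOff {n : ℕ} (m : ℕ) {D : Finset (Fin n)} (hD : ∀ k ∈ D, ¬ IsMax k) :
    Nat.card {a : Fin n → Fin m // AntitoneStrictOff D a} = (m + #D).choose n := by
  rw [Nat.card_congr (antitoneStrictOffEquiv m hD), card_strictAnti, Nat.card_fin]

/-! ### Ranks -/

section Orientation

variable {V α : Type*}

/-- The acyclic orientation of the edges of `G` along which the labels `f` increase. -/
def orientBy [LT α] (G : SimpleGraph V) (f : V → α) (u v : V) : Prop :=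
  G.Adj u v ∧ f u < f v

/-- The lengths, counted in vertices, of the chains of the relation `r` which end in `x`. -/
def chainLengths (r : V → V → Prop) (x : V) : Set ℕ :=
  {k | ∃ w : List V, w.getLast? = some x ∧ w.IsChain r ∧ w.length = k}

theorem one_mem_chainLengths (r : V → V → Prop) (x : V) : 1 ∈ chainLengths r x :=
  ⟨[x], rfl, List.isChain_singleton x, rfl⟩

theorem succ_mem_chainLengths {r : V → V → Prop} {u v : V} (huv : r u v) {k : ℕ}
    (hk : k ∈ chainLengths r u) : k + 1 ∈ chainLengths r v := by
  obtain ⟨w, hlast, hchain, rfl⟩ := hk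
  refine ⟨w ++ [v], by simp, hchain.append (List.isChain_singleton v) ?_, by simp⟩
  simp [hlast, huv]

theorem isChain_orientBy_iff [Preorder α] {G : SimpleGraph V} {f : V → α} {w : List V} :
    w.IsChain (orientBy G f) ↔ w.IsChain G.Adj ∧ w.Pairwise (f · < f ·) := by
  have : IsTrans V (f · < f ·) := ⟨fun _ _ _ => lt_trans⟩
  rw [← List.isChain_iff_pairwise]
  simp only [List.isChain_iff_getElem, ← forall₂_and, orientBy]

theorem bddAbove_chainLengths_orientBy [Finite V] [Preorder α] (G : SimpleGraph V) (f : V → α)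
    (x : V) : BddAbove (chainLengths (orientBy G f) x) := by
  cases nonempty_fintype V
  refine ⟨Fintype.card V, ?_⟩
  rintro _ ⟨w, -, hchain, rfl⟩
  have hnodup : w.Nodup :=
    (isChain_orientBy_iff.1 hchain).2.imp fun h => ne_of_apply_ne f h.ne
  exact hnodup.length_le_card

end Orientation

section Permutation

variable {n : ℕ} {G : SimpleGraph (Fin n)} {σ : Equiv.Perm (Fin n)}

theorem sublist_ofFn_perm_iff (σ : Equiv.Perm (Fin n)) (w : List (Fin n)) :
    w.Sublist (List.ofFn σ) ↔ w.Pairwise (σ.symm · < σ.symm ·) := by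
  have hσ : (List.ofFn σ).Pairwise (σ.symm · < σ.symm ·) :=
    List.pairwise_ofFn.2 fun i j hij => by simpa using hij
  refine ⟨fun h => hσ.sublist h, fun hw => ?_⟩
  have hnodup : w.Nodup := hw.imp fun h => ne_of_apply_ne σ.symm h.ne
  have hsub : w ⊆ List.ofFn σ := fun x _ => (List.mem_ofFn' _ _).2 (σ.surjective x)
  have : Std.Antisymm (σ.symm · ≤ σ.symm ·) :=
    ⟨fun _ _ h h' => σ.symm.injective (le_antisymm h h')⟩
  exact List.sublist_of_subperm_of_pairwise (r := (σ.symm · ≤ σ.symm ·))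
    (hnodup.subperm hsub) (hw.imp le_of_lt) (hσ.imp le_of_lt)

theorem gRank_eq_sSup_chainLengths (G : SimpleGraph (Fin n)) (σ : Equiv.Perm (Fin n)) (x : Fin n) :
    gRank G σ x = sSup (chainLengths (orientBy G σ.symm) x) := by
  refine congrArg sSup (Set.ext fun k => exists_congr fun w => ?_)
  rw [sublist_ofFn_perm_iff, isChain_orientBy_iff]
  tauto

theorem gRank_congr {τ : Equiv.Perm (Fin n)} (h : orientBy G σ.symm = orientBy G τ.symm) :
    gRank G σ = gRank G τ := by
  funext x
  rw [gRank_eq_sSup_chainLengths, gRank_eq_sSup_chainLengths, h]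

theorem gRank_lt_gRank {u v : Fin n} (huv : orientBy G σ.symm u v) :
    gRank G σ u < gRank G σ v := by
  have hbdd := bddAbove_chainLengths_orientBy G σ.symm
  rw [gRank_eq_sSup_chainLengths, gRank_eq_sSup_chainLengths]
  exact le_csSup (hbdd v) <| succ_mem_chainLengths huv <|
    Nat.sSup_mem ⟨1, one_mem_chainLengths _ u⟩ (hbdd u)

/-! ### Sorting the vertices of a colored graph -/

theorem strictAnti_comp_perm_iff {α : Type*} [LinearOrder α] {f : Fin n → α}
    (hf : Function.Injective f) : StrictAnti (f ∘ σ) ↔ σ = Tuple.sort (toDual ∘ f) := by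
  rw [Tuple.eq_sort_iff, ← strictMono_toDual_comp_iff]
  have hinj : Function.Injective ((toDual ∘ f) ∘ σ) :=
    (toDual.injective.comp hf).comp σ.injective
  refine ⟨fun h => ⟨h.monotone, fun i j hij heq => absurd (hinj heq) hij.ne⟩, fun h => ?_⟩
  exact h.1.strictMono_of_injective hinj

/-- The key by which vertices are sorted: color first, then the value of `r`, then the label. -/
def sortKey {α : Type*} (κ : Fin n → α) (r : Fin n → ℕ) (x : Fin n) : α ×ₗ ℕ ×ₗ Fin n :=
  toLex (κ x, toLex (r x, x))

theorem sortKey_injective {α : Type*} (κ : Fin n → α) (r : Fin n → ℕ) :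
    Function.Injective (sortKey κ r) := fun x y h => by
  simp only [sortKey, EmbeddingLike.apply_eq_iff_eq, Prod.mk.injEq] at h
  exact h.2.2

section LinearOrder

variable {α : Type*} [LinearOrder α]

/-- The word of `σ` lists the vertices by decreasing color, vertices of the same color by decreasing
rank, and vertices of the same color and rank by decreasing label. -/
def SortsColoring (G : SimpleGraph (Fin n)) (κ : Fin n → α) (σ : Equiv.Perm (Fin n)) : Prop :=
  StrictAnti (sortKey κ (gRank G σ) ∘ σ)

theorem SortsColoring.lt_of_orientBy {κ : Fin n → α} (h : SortsColoring G κ σ) {u v : Fin n}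
    (huv : orientBy G σ.symm u v) : κ v < κ u := by
  have hkey := h huv.2
  simp only [Function.comp_apply, Equiv.apply_symm_apply, sortKey,
    Prod.Lex.toLex_lt_toLex] at hkey
  have hrank := gRank_lt_gRank huv
  rcases hkey with hlt | ⟨-, hlt | ⟨heq, -⟩⟩
  · exact hlt
  · exact absurd hlt hrank.not_gt
  · exact absurd heq hrank.ne'

theorem SortsColoring.ne_of_adj {κ : Fin n → α} (h : SortsColoring G κ σ) {u v : Fin n}
    (huv : G.Adj u v) : κ u ≠ κ v := by
  rcases lt_or_gt_of_ne (σ.symm.injective.ne huv.ne) with hlt | hlt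
  · exact (h.lt_of_orientBy ⟨huv, hlt⟩).ne'
  · exact (h.lt_of_orientBy ⟨huv.symm, hlt⟩).ne

theorem orientBy_symm_eq_of_strictAnti_sortKey (κ : G.Coloring α) {r : Fin n → ℕ}
    (h : StrictAnti (sortKey κ r ∘ σ)) : orientBy G σ.symm = orientBy G (toDual ∘ κ) := by
  ext u v
  refine and_congr_right fun huv => ?_
  have hlt := h.lt_iff_gt (a := σ.symm v) (b := σ.symm u)
  simp only [Function.comp_apply, Equiv.apply_symm_apply, sortKey, Prod.Lex.toLex_lt_toLex,
    (κ.valid huv).symm, false_and, or_false] at hlt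
  exact hlt.symm

theorem existsUnique_sortsColoring (κ : G.Coloring α) : ∃! σ, SortsColoring G κ σ := by
  let τ := Tuple.sort (toDual ∘ sortKey κ 0)
  have hτ : StrictAnti (sortKey κ 0 ∘ τ) := (strictAnti_comp_perm_iff (sortKey_injective κ 0)).2 rfl
  have hrank {σ : Equiv.Perm (Fin n)} {r : Fin n → ℕ} (hσ : StrictAnti (sortKey κ r ∘ σ)) :
      gRank G σ = gRank G τ :=
    gRank_congr <| (orientBy_symm_eq_of_strictAnti_sortKey κ hσ).trans
      (orientBy_symm_eq_of_strictAnti_sortKey κ hτ).symm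
  have hsorts : ∀ σ, SortsColoring G κ σ ↔ StrictAnti (sortKey κ (gRank G τ) ∘ σ) := fun σ =>
    ⟨fun h => hrank h ▸ h, fun h => by rwa [SortsColoring, hrank h]⟩
  simp only [hsorts, strictAnti_comp_perm_iff (sortKey_injective κ _), existsUnique_eq]

end LinearOrder

theorem not_isMax_of_mem_gDescents {i : Fin n} (hi : i ∈ gDescents G σ) : ¬ IsMax i := by
  obtain ⟨h, -⟩ := (mem_filter.1 hi).2
  exact not_isMax_iff.2 ⟨⟨i + 1, h⟩, Fin.lt_def.2 (Nat.lt_succ_self i)⟩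

theorem mem_gDescents_iff_of_covBy {i j : Fin n} (hij : i ⋖ j) : i ∈ gDescents G σ ↔
    toLex (gRank G σ (σ j), σ j) < toLex (gRank G σ (σ i), σ i) := by
  obtain ⟨j, hj⟩ := j
  obtain rfl : (i : ℕ) + 1 = j := Nat.covBy_iff_add_one_eq.1 (Fin.covBy_iff.1 hij)
  simp only [gDescents, mem_filter, mem_univ, true_and, hj, exists_true_left,
    Prod.Lex.toLex_lt_toLex, eq_comm]

theorem sortsColoring_iff_antitoneStrictOff {α : Type*} [LinearOrder α] {κ : Fin n → α} :
    SortsColoring G κ σ ↔ AntitoneStrictOff (gDescents G σ) (κ ∘ σ) := by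
  rw [SortsColoring, strictAnti_iff_forall_covBy]
  refine forall₃_congr fun i j hij => ?_
  rw [mem_gDescents_iff_of_covBy hij, Function.comp_apply, Function.comp_apply, sortKey, sortKey,
    Prod.Lex.toLex_lt_toLex]
  rfl

theorem card_sortsColoring (m : ℕ) (G : SimpleGraph (Fin n)) (σ : Equiv.Perm (Fin n)) :
    Nat.card {κ : G.Coloring (Fin m) // SortsColoring G κ σ} =
      (m + #(gDescents G σ)).choose n := by
  let e : {κ : G.Coloring (Fin m) // SortsColoring G κ σ} ≃
      {κ : Fin n → Fin m // SortsColoring G κ σ} :=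
    { toFun κ := ⟨κ.1, κ.2⟩
      invFun κ := ⟨SimpleGraph.Coloring.mk κ.1 κ.2.ne_of_adj, κ.2⟩
      left_inv _ := rfl
      right_inv _ := rfl }
  rw [← card_antitoneStrictOff m fun _ => not_isMax_of_mem_gDescents, Nat.card_congr e]
  exact Nat.card_congr ((σ.symm.arrowCongr (Equiv.refl _)).subtypeEquiv fun _ =>
    sortsColoring_iff_antitoneStrictOff)

/-! ### The expansion over permutations -/

theorem mem_diEdges {V : Type*} [Fintype V] {D : Digraph V} {e : V × V} :
    e ∈ diEdges D ↔ D.Adj e.1 e.2 := by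
  simp [diEdges]

theorem adj_toSimpleGraphInclusive {V : Type*} {D : Digraph V} {u v : V} (hne : u ≠ v)
    (h : D.Adj u v) : D.toSimpleGraphInclusive.Adj u v :=
  ⟨hne, Or.inl h⟩

theorem ascCount_eq_diInv {D : Digraph (Fin n)} {m : ℕ}
    {κ : D.toSimpleGraphInclusive.Coloring (Fin m)}
    (h : SortsColoring D.toSimpleGraphInclusive κ σ) : ascCount D κ = diInv D σ := by
  refine congrArg card <| filter_congr fun e he => ?_
  have horient := congrFun₂ (orientBy_symm_eq_of_strictAnti_sortKey κ h) e.2 e.1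
  rcases eq_or_ne e.1 e.2 with heq | hne
  · simp [heq]
  · have hadj := (adj_toSimpleGraphInclusive hne (mem_diEdges.1 he)).symm
    simpa [orientBy, hadj] using horient.symm

theorem tChromatic_eq_sum_perm (D : Digraph (Fin n)) (m : ℕ) :
    tChromatic D m = ∑ σ : Equiv.Perm (Fin n),
      (m + #(gDescents D.toSimpleGraphInclusive σ)).choose n • (X : ℚ[X]) ^ diInv D σ := by
  classical
  let G := D.toSimpleGraphInclusive
  calc
    tChromatic D m = ∑ κ : G.Coloring (Fin m), ∑ σ with SortsColoring G κ σ, X ^ diInv D σ := by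
      refine sum_congr rfl fun κ _ => ?_
      obtain ⟨σ, hσ, huniq⟩ := existsUnique_sortsColoring κ
      have hsingle : ({τ | SortsColoring G κ τ} : Finset (Equiv.Perm (Fin n))) = {σ} :=
        eq_singleton_iff_unique_mem.2 ⟨by simpa using hσ, by simpa using huniq⟩
      rw [hsingle, sum_singleton, ascCount_eq_diInv hσ]
    _ = ∑ σ, ∑ _ ∈ {κ : G.Coloring (Fin m) | SortsColoring G κ σ}, X ^ diInv D σ :=
      sum_comm' (by simp)
    _ = ∑ σ, (m + #(gDescents G σ)).choose n • X ^ diInv D σ := by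
      refine sum_congr rfl fun σ _ => ?_
      rw [sum_const, ← card_sortsColoring, Nat.card_eq_fintype_card, Fintype.card_subtype]

theorem sum_comp_eq_finsum_card_fiber {ι β M : Type*} [Fintype ι] [DecidableEq β]
    [AddCommMonoid M] (g : ι → β) (F : β → M) :
    ∑ i, F (g i) = ∑ᶠ b, #{i | g i = b} • F b := by
  rw [Finset.sum_comp, finsum_eq_sum_of_support_subset]
  intro b hb
  obtain ⟨i, hi⟩ := card_ne_zero.1 (left_ne_zero_of_smul hb)
  exact mem_coe.2 (mem_image.2 ⟨i, mem_univ i, (mem_filter.1 hi).2⟩)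

/-- The pair of the number of descents and the number of inversions of a permutation. -/
noncomputable def desInv (D : Digraph (Fin n)) (σ : Equiv.Perm (Fin n)) : ℕ × ℕ :=
  (#(gDescents D.toSimpleGraphInclusive σ), diInv D σ)

theorem diDelta_eq_card_desInv (D : Digraph (Fin n)) (p : ℕ × ℕ) :
    diDelta D p.1 p.2 = #{σ | desInv D σ = p} := by
  simp only [diDelta, desInv, Prod.ext_iff]

theorem finite_diDelta_ne_zero (D : Digraph (Fin n)) :
    {p : ℕ × ℕ | diDelta D p.1 p.2 ≠ 0}.Finite := by
  refine (Set.finite_range (desInv D)).subset fun p hp => ?_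
  obtain ⟨σ, hσ⟩ := card_ne_zero.1 ((diDelta_eq_card_desInv D p).symm.trans_ne hp)
  exact ⟨σ, (mem_filter.1 hσ).2⟩

theorem tChromatic_eq_finsum (D : Digraph (Fin n)) (m : ℕ) : tChromatic D m =
    ∑ᶠ p : ℕ × ℕ, C ((diDelta D p.1 p.2 : ℚ) * ((m + p.1).choose n : ℚ)) * X ^ p.2 := by
  rw [tChromatic_eq_sum_perm]
  refine (sum_comp_eq_finsum_card_fiber (desInv D)
    fun p => (m + p.1).choose n • (X : ℚ[X]) ^ p.2).trans (finsum_congr fun p => ?_)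
  simp [diDelta_eq_card_desInv, mul_assoc]

/-! ### Palindromic coefficients -/

/-- The binomial coefficient `m + k` choose `n` as a polynomial in `m`. -/
noncomputable def addChoosePolynomial (R : Type*) [CommRing R] [Algebra ℚ R] (n k : ℕ) : R[X] :=
  (n.factorial : ℚ)⁻¹ • (descPochhammer R n).comp (X + C (k : R))

theorem eval_natCast_addChoosePolynomial (R : Type*) [CommRing R] [Algebra ℚ R] (n k m : ℕ) :
    (addChoosePolynomial R n k).eval (m : R) = ((m + k).choose n : R) := by
  have hn : (n.factorial : ℚ) ≠ 0 := Nat.cast_ne_zero.2 n.factorial_ne_zero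
  rw [addChoosePolynomial, eval_smul, eval_comp, eval_add, eval_X, eval_C, ← Nat.cast_add,
    descPochhammer_eval_eq_descFactorial, Nat.descFactorial_eq_factorial_mul_choose,
    Nat.cast_mul, ← nsmul_eq_mul, ← Nat.cast_smul_eq_nsmul ℚ, inv_smul_smul₀ hn]

/-- The `t`-analog of the chromatic polynomial as a polynomial in the number of colors. -/
noncomputable def tChromaticPolynomial (D : Digraph (Fin n)) : ℚ[X][X] :=
  ∑ σ : Equiv.Perm (Fin n),
    addChoosePolynomial ℚ[X] n #(gDescents D.toSimpleGraphInclusive σ) * C (X ^ diInv D σ)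

theorem eval_natCast_tChromaticPolynomial (D : Digraph (Fin n)) (m : ℕ) :
    (tChromaticPolynomial D).eval (m : ℚ[X]) = tChromatic D m := by
  simp only [tChromatic_eq_sum_perm, tChromaticPolynomial, eval_finsetSum, eval_mul, eval_C,
    eval_natCast_addChoosePolynomial, nsmul_eq_mul]

theorem isPalindromicOfCenter_sum_X_pow {ι : Type*} [Fintype ι] {a : ι → ℕ} {N : ℕ} (e : ι ≃ ι)
    (h : ∀ i, a (e i) + a i = N) : IsPalindromicOfCenter N (∑ i, X ^ a i) := by
  refine ⟨natDegree_sum_le_of_forall_le _ _ fun i _ => ?_, fun j hj => ?_⟩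
  · rw [natDegree_X_pow, ← h i]
    exact Nat.le_add_left _ _
  · simp only [finsetSum_coeff, coeff_X_pow]
    refine Fintype.sum_equiv e _ _ fun i => if_congr ?_ rfl rfl
    have := h i
    omega

theorem ascCount_rev_comp_add {V : Type*} [Fintype V] {D : Digraph V} (hD : ∀ v, ¬ D.Adj v v)
    {m : ℕ} (κ : D.toSimpleGraphInclusive.Coloring (Fin m)) :
    ascCount D (Fin.rev ∘ κ) + ascCount D κ = #(diEdges D) := by
  unfold ascCount
  rw [add_comm, ← card_filter_add_card_filter_not (s := diEdges D) fun e => κ e.1 < κ e.2]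
  congr 2
  refine filter_congr fun e he => ?_
  have hadj := mem_diEdges.1 he
  have hne : e.1 ≠ e.2 := fun heq => hD e.1 (heq ▸ hadj)
  have := κ.valid (adj_toSimpleGraphInclusive hne hadj)
  rw [Function.comp_apply, Function.comp_apply, Fin.rev_lt_rev, not_lt, this.symm.le_iff_lt]

theorem isPalindromicOfCenter_tChromatic {V : Type*} [Fintype V] {D : Digraph V}
    (hD : ∀ v, ¬ D.Adj v v) (m : ℕ) : IsPalindromicOfCenter #(diEdges D) (tChromatic D m) :=
  isPalindromicOfCenter_sum_X_pow (SimpleGraph.recolorOfEquiv _ Fin.revPerm)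
    (ascCount_rev_comp_add hD)

theorem map_coeff_eq_zero_of_eval_natCast {K A : Type*} [CommRing K] [IsDomain K] [CharZero K]
    [Semiring A] (L : A →+ K) {P : A[X]} (h : ∀ m : ℕ, L (P.eval (m : A)) = 0) (j : ℕ) :
    L (P.coeff j) = 0 := by
  let Q : K[X] := ∑ i ∈ P.support, monomial i (L (P.coeff i))
  have hcoeff : Q.coeff j = L (P.coeff j) := by
    simp only [Q, finsetSum_coeff, coeff_monomial, sum_ite_eq', mem_support_iff]
    exact ite_eq_left_iff.2 fun hj => by rw [notMem_support_iff.1 hj, map_zero]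
  have heval : ∀ m : ℕ, Q.eval (m : K) = 0 := fun m => by
    rw [← h m, eval_eq_sum (p := P), Polynomial.sum, map_sum, eval_finsetSum]
    refine sum_congr rfl fun i _ => ?_
    rw [eval_monomial, ← Nat.cast_pow, ← Nat.cast_pow, ← nsmul_eq_mul', ← nsmul_eq_mul',
      map_nsmul]
  have hQ : Q = 0 := eq_zero_of_infinite_isRoot Q <|
    (Set.infinite_range_of_injective Nat.cast_injective).mono (Set.range_subset_iff.2 heval)
  rw [← hcoeff, hQ, coeff_zero]

theorem isPalindromicOfCenter_coeff_of_eval_natCast {N : ℕ} {P : ℚ[X][X]}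
    (h : ∀ m : ℕ, IsPalindromicOfCenter N (P.eval (m : ℚ[X]))) (j : ℕ) :
    IsPalindromicOfCenter N (P.coeff j) := by
  refine ⟨natDegree_le_iff_coeff_eq_zero.2 fun i hi => ?_, fun i hi => ?_⟩
  · exact map_coeff_eq_zero_of_eval_natCast (lcoeff ℚ i).toAddMonoidHom
      (fun m => coeff_eq_zero_of_natDegree_lt ((h m).1.trans_lt hi)) j
  · exact sub_eq_zero.1 <| map_coeff_eq_zero_of_eval_natCast
      (lcoeff ℚ i - lcoeff ℚ (N - i)).toAddMonoidHom
      (fun m => sub_eq_zero.2 ((h m).2 i hi)) j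

end Permutation

theorem corollary3p3 (n : ℕ) (D : Digraph (Fin n)) (hD : ∀ v : Fin n, ¬ D.Adj v v) :
    {p : ℕ × ℕ | diDelta D p.1 p.2 ≠ 0}.Finite ∧
    (∀ m : ℕ, tChromatic D m =
      ∑ᶠ p : ℕ × ℕ, C ((diDelta D p.1 p.2 : ℚ) * ((m + p.1).choose n : ℚ)) * X ^ p.2) ∧
    (∃ P : ℚ[X][X],
      (∀ m : ℕ, tChromatic D m = P.eval (m : ℚ[X])) ∧
      ∀ j : ℕ, IsPalindromicOfCenter (diEdges D).card (P.coeff j)) := by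
  have heval := eval_natCast_tChromaticPolynomial D
  refine ⟨finite_diDelta_ne_zero D, tChromatic_eq_finsum D, tChromaticPolynomial D,
    fun m => (heval m).symm, isPalindromicOfCenter_coeff_of_eval_natCast fun m => ?_⟩
  exact (heval m).symm ▸ isPalindromicOfCenter_tChromatic hD m
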